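/- Let $T=(V,E)$ be a finite tree with $|V|=p\ge 2$. Let $\mathbf a=(a_i)_{i\in V}$ with all $a_i>0$, and let $\mathbf C=[c_{i,j}]_{i,j\in V}$ be a symmetric real matrix with $c_i:=c_{i,i}>0$ for all $i\in V$, $c_{i,j}>0$ if $\{i,j\}\in E$, and $c_{i,j}=0$ otherwise. The tree-Kummer distribution $\mathrm{TK}(\mathbf a,\mathbf C)$ is the probability distribution on $\mathbb R^V$ with density $$ f(\mathbf x)\;\propto\;\prod_{i\in V}x_i^{a_i-1}\,\exp\Big(-\sum_{S\subseteq T}\ \prod_{i\in V(S)}\frac{x_i}{c_i^{\deg_S(i)-1}}\prod_{\{j,k\}\in E(S)}c_{j,k}\Big)\,\mathbf 1_{(0,\infty)^V}(\mathbf x), $$ where the sum runs over all subtrees $S$ of $T$, that is, over all non-empty connected induced subgraphs $S=(V(S),E(S))$ of $T$ (one-vertex subtrees, with $\deg_S(i)=0$, included). For $r\in V$ direct $T$ away from the root $r$; let $\mathfrak C_r(i)$ be the set of children of $i$ and, for $i\ne r$, let $\mathfrak p_r(i)$ be the parent of $i$. Define $\Phi_r(s_i,\,i\in V)=(s_{i,(r)},\,i\in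 V)$ recursively, starting from the vertices farthest from $r$, by $$ s_{i,(r)}=s_i\prod_{j\in\mathfrak C_r(i)}\Big(1+\frac{c_{i,j}}{c_i}\,s_{j,(r)}\Big), $$ an empty product being $1$. For $\alpha,\gamma>0$ and $\beta\in\mathbb R$, let $\mathcal G(\alpha,\gamma)$ be the Gamma distribution with density $\propto x^{\alpha-1}e^{-\gamma x}\mathbf 1_{(0,\infty)}(x)$ and $\mathcal K(\alpha,\beta,\gamma)$ the Kummer distribution with density $\propto \dfrac{x^{\alpha-1}}{(1+x)^{\alpha+\beta}}e^{-\gamma x}\mathbf 1_{(0,\infty)}(x)$. Let $\mathbf S=(S_i)_{i\in V}$ be a random vector with distribution $\mathrm{TK}(\mathbf a,\mathbf C)$. Then for every $r\in V$ the components of the random vector $(X_{i,(r)})_{i\in V}=\Phi_r(\mathbf S)$ are independent. Moreover, $$ X_{r,(r)}\sim\mathcal G(a_r,c_r) \quad\text{and}\quad \frac{c_{\mathfrak p_r(i),i}}{c_{\mathfrak p_r(i)}}\,X_{i,(r)}\sim\mathcal K\Big(a_i,\;a_{\mathfrak p_r(i)}-a_i,\;\frac{c_{\mathfrak p_r(i)}\,c_i}{c_{\mathfrak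 p_r(i),i}}\Big)\quad\text{for all } i\in V\setminus\{r\}. $$ -/

import Mathlib

open MeasureTheory ProbabilityTheory
open scoped ENNReal

noncomputable section

namespace TreeKummer

/-- The probability measure whose density with respect to `ν` is proportional to `f`
(the zero measure if `f` cannot be normalized). -/
def densityPropTo {X : Type*} [MeasurableSpace X] (ν : Measure X) (f : X → ℝ) : Measure X :=
  (∫⁻ x, ENNReal.ofReal (f x) ∂ν)⁻¹ • ν.withDensity (fun x => ENNReal.ofReal (f x))

/-- Unnormalized density of the Kummer distribution `K(α, β, γ)`. -/
def kummerWeight (α β γ x : ℝ) : ℝ :=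
  (Set.Ioi (0 : ℝ)).indicator
    (fun x => x ^ (α - 1) / (1 + x) ^ (α + β) * Real.exp (-(γ * x))) x

/-- The Kummer distribution `K(α, β, γ)`. -/
def kummerMeasure (α β γ : ℝ) : Measure ℝ :=
  densityPropTo volume (kummerWeight α β γ)

/-- The set `C_T`: symmetric matrices indexed by the vertices, positive on the diagonal and on the
edges of `T`, and zero elsewhere. -/
structure TreeMatrix {V : Type*} (T : SimpleGraph V) where
  c : Matrix V V ℝ
  isSymm : c.IsSymm
  diag_pos : ∀ i, 0 < c i i
  edge_pos : ∀ i j, T.Adj i j → 0 < c i j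
  eq_zero : ∀ i j, i ≠ j → ¬ T.Adj i j → c i j = 0

/-- The weight `c_{j,k}` of the unordered pair `{j, k}`. -/
def TreeMatrix.edgeWeight {V : Type*} {T : SimpleGraph V} (C : TreeMatrix T) : Sym2 V → ℝ :=
  Sym2.lift ⟨fun j k => C.c j k, fun j k => C.isSymm.apply k j⟩

section Finite

variable {V : Type*} [Fintype V]

open Classical in
/-- The vertex sets `A` of the subtrees of `T`; the subtree on `A` is the graph induced by `T`
(being a tree, it is connected, and `A` is not empty). -/
def subtrees (T : SimpleGraph V) : Finset (Finset V) :=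
  Finset.univ.filter fun A => (T.induce (A : Set V)).IsTree

open Classical in
/-- The degree of the vertex `i` of `A` in the subgraph induced on `A`. -/
def degIn (T : SimpleGraph V) (A : Finset V) (i : V) : ℕ :=
  (A.filter fun l => T.Adj l i).card

open Classical in
/-- The edges of the subgraph induced on `A`. -/
def edgesIn (T : SimpleGraph V) (A : Finset V) : Finset (Sym2 V) :=
  T.edgeFinset.filter fun e => ∀ v ∈ e, v ∈ A

/-- The sum over all subtrees in the exponent of the tree-Kummer density. The exponent
`deg - 1` is an integer, equal to `-1` for one-vertex subtrees. -/
def treeEnergy (T : SimpleGraph V) (C : TreeMatrix T) (x : V → ℝ) : ℝ :=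
  ∑ A ∈ subtrees T,
    (∏ i ∈ A, x i / C.c i i ^ ((degIn T A i : ℤ) - 1)) * ∏ e ∈ edgesIn T A, C.edgeWeight e

/-- Unnormalized density of the tree-Kummer distribution `TK(a, C)`. -/
def treeKummerWeight (T : SimpleGraph V) (a : V → ℝ) (C : TreeMatrix T) (x : V → ℝ) : ℝ :=
  {x : V → ℝ | ∀ i, 0 < x i}.indicator
    (fun x => (∏ i, x i ^ (a i - 1)) * Real.exp (-treeEnergy T C x)) x

/-- The tree-Kummer distribution `TK(a, C)` on `(0, ∞)^V`. -/
def treeKummerMeasure (T : SimpleGraph V) (a : V → ℝ) (C : TreeMatrix T) : Measure (V → ℝ) :=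
  densityPropTo volume (treeKummerWeight T a C)

open Classical in
/-- The children of `i` when `T` is directed away from the root `r`. -/
def children (T : SimpleGraph V) (r i : V) : Finset V :=
  Finset.univ.filter fun j => T.Adj i j ∧ T.dist r j = T.dist r i + 1

lemma mem_children {T : SimpleGraph V} {r i j : V} :
    j ∈ children T r i ↔ T.Adj i j ∧ T.dist r j = T.dist r i + 1 := by
  simp [children]

/-- In a tree rooted at `r`, every vertex but the root has exactly one parent. -/
lemma existsUnique_parent {T : SimpleGraph V} (hT : T.IsTree) {r i : V} (hi : i ≠ r) :
    ∃! j, i ∈ children T r j := by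
  obtain ⟨p, hp⟩ := hT.connected.exists_walk_length_eq_dist i r
  cases p with
  | nil => exact absurd rfl hi
  | @cons _ j _ h q =>
    have h1 : T.dist j r ≤ q.length := SimpleGraph.dist_le q
    have h2 : T.dist i r ≤ T.dist i j + T.dist j r := hT.connected.dist_triangle
    have h3 : T.dist i j = 1 := SimpleGraph.dist_eq_one_iff_adj.mpr h
    rw [SimpleGraph.Walk.length_cons] at hp
    have h4 : T.dist i r = T.dist j r + 1 := by omega
    have hpath : (SimpleGraph.Walk.cons h q).IsPath :=
      SimpleGraph.Walk.isPath_of_length_eq_dist _ (by simpa using hp)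
    refine ⟨j, mem_children.2 ⟨h.symm, ?_⟩, ?_⟩
    · rw [T.dist_comm (u := r), T.dist_comm (u := r)]; exact h4
    · intro k hk
      obtain ⟨hk1, hk2⟩ := mem_children.1 hk
      rw [T.dist_comm (u := r), T.dist_comm (u := r)] at hk2
      obtain ⟨q', hq'⟩ := hT.connected.exists_walk_length_eq_dist k r
      have hpath' : (SimpleGraph.Walk.cons hk1.symm q').IsPath :=
        SimpleGraph.Walk.isPath_of_length_eq_dist _ (by
          rw [SimpleGraph.Walk.length_cons]; omega)
      have := (hT.existsUnique_path i r).unique hpath' hpath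
      simpa using congrArg SimpleGraph.Walk.snd this

/-- The parent of `i ≠ r` in the tree `T` directed away from the root `r`. -/
def parent {T : SimpleGraph V} (hT : T.IsTree) (r i : V) (hi : i ≠ r) : V :=
  (existsUnique_parent hT hi).choose

/-- The components `s_{i,(r)} = s_i ∏_{j ∈ children(i)} (1 + (c_{i,j} / c_i) s_{j,(r)})` of the
transformation `Φ_r`, defined recursively from the vertices farthest from the root. -/
def phi (T : SimpleGraph V) (C : TreeMatrix T) (r : V) (s : V → ℝ) (i : V) : ℝ :=
  s i * ∏ j : {j // j ∈ children T r i}, (1 + C.c i j / C.c i i * phi T C r s j)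
termination_by Finset.univ.sup (T.dist r) - T.dist r i
decreasing_by
  have h1 := (mem_children.1 j.2).2
  have h2 : T.dist r j.1 ≤ Finset.univ.sup (T.dist r) := Finset.le_sup (Finset.mem_univ j.1)
  omega

lemma phi_eq (T : SimpleGraph V) (C : TreeMatrix T) (r : V) (s : V → ℝ) (i : V) :
    phi T C r s i = s i * ∏ j ∈ children T r i, (1 + C.c i j / C.c i i * phi T C r s j) := by
  rw [phi, Finset.prod_coe_sort (children T r i)
    (fun j => 1 + C.c i j / C.c i i * phi T C r s j)]

end Finite

end TreeKummer

end

/-!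
In the coordinates `y = Φ_r(x)` the energy is linear: `∑_S (term of S) = ∑ i, c_i y_i`. To see this,
attach the vertices one at a time in order of their distance to `r`. When `w` is attached, the new
subtrees are `{w}`, which contributes `c_w y_w` together with its extensions below `w`, and the
subtrees that contained the parent `p` of `w` with `w` added, which turns their factor `1` into
`1 + (c_{p,w} / c_p) y_w`. These factors are exactly the ones that occur in `Φ_r`.

The map `Φ_r` is a bijection of the positive orthant whose inverse divides the coordinate `i` by a
function of the coordinates of the children of `i`. Ordered by depth, its derivative is triangular,
so the Jacobian is the product of these divisors. Hence the density of `Φ_r(S)` is a product of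
functions of one variable, with a factor `(1 + (c_{p,i} / c_p) y_i) ^ (-a_p)` for each edge from `p`
to its child `i`: a Gamma weight at the root and a rescaled Kummer weight at every other vertex.
-/

noncomputable section

namespace TreeKummer

section ProductIntegral

lemma lintegral_fin_prod_eq_prod {n : ℕ} {E : Fin n → Type*} {mE : ∀ i, MeasurableSpace (E i)}
    {μ : (i : Fin n) → Measure (E i)} [∀ i, SigmaFinite (μ i)]
    {f : (i : Fin n) → E i → ℝ≥0∞} (hf : ∀ i, Measurable (f i)) :
    ∫⁻ x, ∏ i, f i (x i) ∂(Measure.pi μ) = ∏ i, ∫⁻ x, f i x ∂(μ i) := by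
  induction n with
  | zero => simp
  | succ n ih =>
    have htail : Measurable fun x : (i : Fin n) → E i.succ => ∏ i, f i.succ (x i) :=
      Finset.measurable_prod _ fun i _ => (hf i.succ).comp (measurable_pi_apply i)
    rw [← (measurePreserving_piFinSuccAbove μ 0).symm.lintegral_comp_emb
      (MeasurableEquiv.measurableEmbedding _)]
    simp_rw [MeasurableEquiv.piFinSuccAbove_symm_apply, Fin.insertNthEquiv,
      Fin.prod_univ_succ, Fin.insertNth_zero, Fin.zero_succAbove]
    rw [← ih fun i => hf i.succ, ← lintegral_prod_mul (hf 0).aemeasurable htail.aemeasurable]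
    rfl

lemma lintegral_fintype_prod_eq_prod {ι : Type*} [Fintype ι] {E : ι → Type*}
    {mE : ∀ i, MeasurableSpace (E i)} {μ : (i : ι) → Measure (E i)} [∀ i, SigmaFinite (μ i)]
    {f : (i : ι) → E i → ℝ≥0∞} (hf : ∀ i, Measurable (f i)) :
    ∫⁻ x, ∏ i, f i (x i) ∂(Measure.pi μ) = ∏ i, ∫⁻ x, f i x ∂(μ i) := by
  let e := (Fintype.equivFin ι).symm
  rw [← (measurePreserving_piCongrLeft _ e).lintegral_comp_emb
    (MeasurableEquiv.measurableEmbedding _)]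
  simp_rw [← e.prod_comp, MeasurableEquiv.coe_piCongrLeft, Equiv.piCongrLeft_apply_apply]
  exact lintegral_fin_prod_eq_prod fun i => hf _

end ProductIntegral

section DensityPropTo

variable {X Y : Type*} [MeasurableSpace X] [MeasurableSpace Y]

lemma densityPropTo_apply (ν : Measure X) (f : X → ℝ) {s : Set X} (hs : MeasurableSet s) :
    densityPropTo ν f s =
      (∫⁻ x, ENNReal.ofReal (f x) ∂ν)⁻¹ * ∫⁻ x in s, ENNReal.ofReal (f x) ∂ν := by
  rw [densityPropTo, Measure.smul_apply, withDensity_apply _ hs, smul_eq_mul]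

lemma isProbabilityMeasure_densityPropTo {ν : Measure X} {f : X → ℝ}
    (h0 : ∫⁻ x, ENNReal.ofReal (f x) ∂ν ≠ 0) (htop : ∫⁻ x, ENNReal.ofReal (f x) ∂ν ≠ ∞) :
    IsProbabilityMeasure (densityPropTo ν f) :=
  ⟨by rw [densityPropTo_apply _ _ .univ, Measure.restrict_univ, ENNReal.inv_mul_cancel h0 htop]⟩

lemma densityPropTo_congr_ae {ν : Measure X} {f g : X → ℝ} (h : f =ᵐ[ν] g) :
    densityPropTo ν f = densityPropTo ν g := by
  have h' : (fun x => ENNReal.ofReal (f x)) =ᵐ[ν] fun x => ENNReal.ofReal (g x) :=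
    h.fun_comp ENNReal.ofReal
  rw [densityPropTo, densityPropTo, lintegral_congr_ae h', withDensity_congr_ae h']

lemma densityPropTo_const_mul (ν : Measure X) (f : X → ℝ) {c : ℝ} (hc : 0 < c) :
    densityPropTo ν (fun x => c * f x) = densityPropTo ν f := by
  have h0 : ENNReal.ofReal c ≠ 0 := (ENNReal.ofReal_pos.2 hc).ne'
  have htop : ENNReal.ofReal c ≠ ∞ := ENNReal.ofReal_ne_top
  ext s hs
  simp_rw [densityPropTo_apply _ _ hs, ENNReal.ofReal_mul hc.le, lintegral_const_mul' _ _ htop]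
  rw [ENNReal.mul_inv (.inl h0) (.inl htop), mul_mul_mul_comm, ENNReal.inv_mul_cancel h0 htop,
    one_mul]

lemma densityPropTo_eq_withDensity {ν : Measure X} {f : X → ℝ}
    (h : ∫⁻ x, ENNReal.ofReal (f x) ∂ν = 1) :
    densityPropTo ν f = ν.withDensity fun x => ENNReal.ofReal (f x) := by
  rw [densityPropTo, h, inv_one, one_smul]

lemma map_densityPropTo_of_map_withDensity {ν : Measure X} {ν' : Measure Y} {f : X → ℝ}
    {g : Y → ℝ} {φ : X → Y} (hφ : Measurable φ)
    (h : (ν.withDensity fun x => ENNReal.ofReal (f x)).map φ =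
      ν'.withDensity fun y => ENNReal.ofReal (g y)) :
    (densityPropTo ν f).map φ = densityPropTo ν' g := by
  have hmass : ∫⁻ x, ENNReal.ofReal (f x) ∂ν = ∫⁻ y, ENNReal.ofReal (g y) ∂ν' := by
    simpa [Measure.map_apply hφ] using congrArg (· Set.univ) h
  rw [densityPropTo, Measure.map_smul, h, hmass, densityPropTo]

lemma densityPropTo_pi {ι : Type*} [Fintype ι] {E : ι → Type*} [∀ i, MeasurableSpace (E i)]
    {ν : (i : ι) → Measure (E i)} [∀ i, SigmaFinite (ν i)] {f : (i : ι) → E i → ℝ}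
    (hf : ∀ i, Measurable (f i)) (hnonneg : ∀ i x, 0 ≤ f i x)
    (h0 : ∀ i, ∫⁻ x, ENNReal.ofReal (f i x) ∂ν i ≠ 0)
    (htop : ∀ i, ∫⁻ x, ENNReal.ofReal (f i x) ∂ν i ≠ ∞) :
    densityPropTo (Measure.pi ν) (fun x => ∏ i, f i (x i)) =
      Measure.pi fun i => densityPropTo (ν i) (f i) := by
  have hprob i := isProbabilityMeasure_densityPropTo (h0 i) (htop i)
  have hmeas i : Measurable fun x => ENNReal.ofReal (f i x) := (hf i).ennreal_ofReal
  refine (Measure.pi_eq fun s hs => ?_).symm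
  simp_rw [densityPropTo_apply _ _ (MeasurableSet.univ_pi hs), densityPropTo_apply _ _ (hs _),
    ENNReal.ofReal_prod_of_nonneg fun i _ => hnonneg i _, Measure.restrict_pi_pi,
    lintegral_fintype_prod_eq_prod hmeas, Finset.prod_mul_distrib]
  rw [ENNReal.prod_inv_distrib fun i _ _ _ _ => .inl (h0 i)]

end DensityPropTo

section ChangeOfVariables

variable {E : Type*} [NormedAddCommGroup E] [NormedSpace ℝ E] [FiniteDimensional ℝ E]
  [MeasurableSpace E] [BorelSpace E] {μ : Measure E} [μ.IsAddHaarMeasure] {s : Set E} {φ ψ : E → E}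
  {ψ' : E → E →L[ℝ] E}

lemma map_withDensity_of_leftInvOn (hs : MeasurableSet s) (hφ : Measurable φ)
    (hψ : ∀ y ∈ s, HasFDerivWithinAt ψ (ψ' y) s y) (hφψ : Set.LeftInvOn φ ψ s) {f g : E → ℝ≥0∞}
    (hf : f.support ⊆ ψ '' s) (hg : g.support ⊆ s)
    (hfg : ∀ y ∈ s, g y = ENNReal.ofReal |(ψ' y).det| * f (ψ y)) :
    (μ.withDensity f).map φ = μ.withDensity g := by
  have himage := measurable_image_of_fderivWithin hs hψ hφψ.injOn
  ext t ht
  have hst : ψ '' s ∩ φ ⁻¹' t = ψ '' (s ∩ t) := by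
    rw [← Set.image_inter_preimage]
    exact congrArg (ψ '' ·) (Set.ext fun y => and_congr_right fun hy => by simp [hφψ hy])
  rw [Measure.map_apply hφ ht, withDensity_apply _ (hφ ht), withDensity_apply _ ht]
  calc ∫⁻ x in φ ⁻¹' t, f x ∂μ = ∫⁻ x in ψ '' (s ∩ t), f x ∂μ := by
        rw [← setLIntegral_eq_of_support_subset hf, Measure.restrict_restrict himage, hst]
    _ = ∫⁻ y in s ∩ t, ENNReal.ofReal |(ψ' y).det| * f (ψ y) ∂μ :=
        lintegral_image_eq_lintegral_abs_det_fderiv_mul μ (hs.inter ht)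
          (fun y hy => (hψ y hy.1).mono Set.inter_subset_left)
          (hφψ.injOn.mono Set.inter_subset_left) f
    _ = ∫⁻ y in s ∩ t, g y ∂μ :=
        setLIntegral_congr_fun (hs.inter ht) fun y hy => (hfg y hy.1).symm
    _ = ∫⁻ y in t, g y ∂μ := by
        rw [← Measure.restrict_restrict hs, setLIntegral_eq_of_support_subset hg]

lemma map_densityPropTo_of_leftInvOn (hs : MeasurableSet s)
    (hφ : Measurable φ) (hψ : ∀ y ∈ s, HasFDerivWithinAt ψ (ψ' y) s y)
    (hφψ : Set.LeftInvOn φ ψ s) {f g : E → ℝ} (hf : f.support ⊆ ψ '' s) (hg : g.support ⊆ s)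
    (hfg : ∀ y ∈ s, g y = |(ψ' y).det| * f (ψ y)) :
    (densityPropTo μ f).map φ = densityPropTo μ g := by
  have hsupport (u : E → ℝ) : (fun x => ENNReal.ofReal (u x)).support ⊆ u.support :=
    Function.support_comp_subset ENNReal.ofReal_zero u
  refine map_densityPropTo_of_map_withDensity hφ <|
    map_withDensity_of_leftInvOn hs hφ hψ hφψ ((hsupport f).trans hf)
      ((hsupport g).trans hg) fun y hy => ?_
  rw [hfg y hy, ENNReal.ofReal_mul (abs_nonneg _)]

lemma map_const_mul_densityPropTo {κ : ℝ} (hκ : κ ≠ 0) (f : ℝ → ℝ) :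
    (densityPropTo volume f).map (κ * ·) = densityPropTo volume fun y => f (κ⁻¹ * y) := by
  rw [← densityPropTo_const_mul _ (fun y => f (κ⁻¹ * y)) (abs_pos.2 (inv_ne_zero hκ))]
  refine map_densityPropTo_of_leftInvOn (ψ := (κ⁻¹ * ·))
    (ψ' := fun _ => ContinuousLinearMap.toSpanSingleton ℝ κ⁻¹) .univ (measurable_const_mul κ)
    (fun y _ => ?_) (fun y _ => mul_inv_cancel_left₀ hκ y) (fun x _ => ?_) (Set.subset_univ _)
    fun y _ => by rw [ContinuousLinearMap.det_toSpanSingleton]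
  · simpa using ((hasDerivAt_id y).const_mul κ⁻¹).hasFDerivAt
  · exact ⟨κ * x, trivial, inv_mul_cancel_left₀ hκ x⟩

end ChangeOfVariables

section RootedTree

variable {V : Type*} [Fintype V] {T : SimpleGraph V} {r i j k : V}

lemma dist_of_mem_children (h : j ∈ children T r i) : T.dist r j = T.dist r i + 1 :=
  (mem_children.1 h).2

lemma notMem_children_of_dist_le (h : T.dist r j ≤ T.dist r i) : j ∉ children T r i := fun hj => by
  have := dist_of_mem_children hj
  omega

lemma ne_root_of_mem_children (h : j ∈ children T r i) : j ≠ r := by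
  rintro rfl
  exact notMem_children_of_dist_le (by simp) h

lemma eq_of_mem_children (hT : T.IsTree) (hi : k ∈ children T r i) (hj : k ∈ children T r j) :
    i = j :=
  (existsUnique_parent hT (ne_root_of_mem_children hi)).unique hi hj

lemma mem_children_parent (hT : T.IsTree) (hi : i ≠ r) : i ∈ children T r (parent hT r i hi) :=
  (existsUnique_parent hT hi).choose_spec.1

lemma mem_children_of_adj_of_dist_le (hT : T.IsTree) (h : T.Adj i j)
    (hle : T.dist r i ≤ T.dist r j) : j ∈ children T r i := by
  refine mem_children.2 ⟨h, ?_⟩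
  rcases hT.dist_eq_dist_add_one_of_adj r h with h' | h' <;> omega

lemma children_induction {P : V → Prop} (T : SimpleGraph V) (r : V)
    (h : ∀ i, (∀ j ∈ children T r i, P j) → P i) (i : V) : P i := by
  induction hn : Finset.univ.sup (T.dist r) - T.dist r i using Nat.strong_induction_on
    generalizing i with
  | _ n ih =>
    refine h i fun j hj => ih _ ?_ j rfl
    have hdist := dist_of_mem_children hj
    have hle : T.dist r j ≤ Finset.univ.sup (T.dist r) := Finset.le_sup (Finset.mem_univ j)
    omega

end RootedTree

section LeafAttachment

lemma connected_induce_insert_iff {V : Type*} {G : SimpleGraph V} {s : Set V} {w : V}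
    (hs : s.Nonempty) (hw : w ∉ s) (hleaf : (G.neighborSet w ∩ s).Subsingleton) :
    (G.induce (insert w s)).Connected ↔ (G.induce s).Connected ∧ ∃ p ∈ s, G.Adj w p := by
  have hnonempty := hs.to_subtype
  constructor
  · intro h
    have hnontrivial : Nontrivial ↥(insert w s) :=
      (Set.nontrivial_of_exists_ne (Set.mem_insert w s)
        (hs.imp fun x hx => ⟨.inr hx, ne_of_mem_of_not_mem hx hw⟩)).coe_sort
    have hpre : ((G.induce (insert w s)).induce {x | x.1 ≠ w}).Preconnected := by
      refine h.preconnected.induce_of_degree_eq_one fun v hv x hx y hy => Subtype.ext ?_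
      have hvw : v.1 = w := by simpa using hv
      replace hx : G.Adj v x := hx
      replace hy : G.Adj v y := hy
      rw [hvw] at hx hy
      exact hleaf ⟨hx, x.2.resolve_left hx.ne'⟩ ⟨hy, y.2.resolve_left hy.ne'⟩
    let toInduce : (G.induce (insert w s)).induce {x | x.1 ≠ w} →g G.induce s :=
      ⟨fun x => ⟨x.1.1, x.1.2.resolve_left x.2⟩, id⟩
    have hsurj : Function.Surjective toInduce := fun x =>
      ⟨⟨⟨x, .inr x.2⟩, ne_of_mem_of_not_mem x.2 hw⟩, rfl⟩
    obtain ⟨p, hp⟩ := h.preconnected.exists_adj_of_nontrivial ⟨w, Set.mem_insert w s⟩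
    replace hp : G.Adj w p := hp
    exact ⟨⟨hpre.map toInduce hsurj⟩, p, p.2.resolve_left hp.ne', hp⟩
  · rintro ⟨h, p, hp, hadj⟩
    rw [Set.insert_eq]
    exact SimpleGraph.connected_induce_union .of_subsingleton h.preconnected
      (Set.mem_singleton w) hp hadj

variable {V : Type*} {T : SimpleGraph V} {A : Finset V} {p w : V}

lemma degIn_insert_leaf_self [DecidableEq V] (hp : p ∈ A) (hadj : ∀ l ∈ A, T.Adj l w ↔ l = p) :
    degIn T (insert w A) w = 1 := by
  classical
  rw [degIn, Finset.card_eq_one]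
  refine ⟨p, ?_⟩
  grind [SimpleGraph.irrefl]

lemma degIn_insert_leaf_of_mem [DecidableEq V] (hw : w ∉ A)
    (hadj : ∀ l ∈ A, T.Adj l w ↔ l = p) {k : V} (hk : k ∈ A) :
    degIn T (insert w A) k = degIn T A k + if k = p then 1 else 0 := by
  classical
  simp only [degIn, Finset.filter_insert, T.adj_comm w k, hadj k hk]
  split_ifs
  · exact Finset.card_insert_of_notMem fun h => hw (Finset.mem_filter.1 h).1
  · rfl

lemma edgesIn_insert_leaf [Fintype V] [DecidableEq V] (hp : p ∈ A)
    (hadj : ∀ l ∈ A, T.Adj l w ↔ l = p) :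
    edgesIn T (insert w A) = insert s(p, w) (edgesIn T A) := by
  have hpw : T.Adj p w := (hadj p hp).2 rfl
  ext e
  induction e using Sym2.inductionOn with
  | _ u v =>
    simp only [edgesIn, Finset.mem_filter, SimpleGraph.mem_edgeFinset, SimpleGraph.mem_edgeSet,
      Sym2.mem_iff, forall_eq_or_imp, forall_eq, Finset.mem_insert, Sym2.eq_iff]
    grind [SimpleGraph.adj_comm, SimpleGraph.irrefl]

end LeafAttachment

section Energy

variable {V : Type*} [Fintype V] {T : SimpleGraph V}

/-- The contribution of the subtree on `A` to the energy of the tree-Kummer density. -/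
def subtreeTerm (T : SimpleGraph V) (C : TreeMatrix T) (x : V → ℝ) (A : Finset V) : ℝ :=
  (∏ i ∈ A, x i / C.c i i ^ ((degIn T A i : ℤ) - 1)) * ∏ e ∈ edgesIn T A, C.edgeWeight e

lemma subtreeTerm_singleton (C : TreeMatrix T) (x : V → ℝ) (w : V) :
    subtreeTerm T C x {w} = C.c w w * x w := by
  have hdeg : degIn T {w} w = 0 := by simp [degIn, Finset.filter_singleton]
  have hedges : edgesIn T {w} = ∅ := by
    ext e
    induction e using Sym2.inductionOn with
    | _ u v =>
      simp only [edgesIn, Finset.mem_filter, SimpleGraph.mem_edgeFinset, SimpleGraph.mem_edgeSet,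
        Sym2.mem_iff, forall_eq_or_imp, forall_eq, Finset.mem_singleton, Finset.notMem_empty]
      grind [SimpleGraph.irrefl]
  simp [subtreeTerm, hdeg, hedges, mul_comm]

lemma subtreeTerm_insert_leaf [DecidableEq V] (C : TreeMatrix T) (x : V → ℝ) {A : Finset V}
    {p w : V} (hw : w ∉ A) (hp : p ∈ A) (hadj : ∀ l ∈ A, T.Adj l w ↔ l = p) :
    subtreeTerm T C x (insert w A) = subtreeTerm T C x A * (C.c p w / C.c p p * x w) := by
  have hvertices : ∏ k ∈ A, x k / C.c k k ^ ((degIn T (insert w A) k : ℤ) - 1) =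
      (∏ k ∈ A, x k / C.c k k ^ ((degIn T A k : ℤ) - 1)) * (C.c p p)⁻¹ := by
    rw [← Finset.prod_ite_eq_of_mem' A p (fun k => (C.c k k)⁻¹) hp, ← Finset.prod_mul_distrib]
    refine Finset.prod_congr rfl fun k hk => ?_
    rw [degIn_insert_leaf_of_mem hw hadj hk]
    have hck := (C.diag_pos k).ne'
    split_ifs
    · rw [Nat.cast_add, Nat.cast_one, add_sub_right_comm, zpow_add_one₀ hck, ← div_div,
        div_eq_mul_inv _ (C.c k k)]
    · simp
  have hweight : C.edgeWeight s(p, w) = C.c p w := rfl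
  have hedge : s(p, w) ∉ edgesIn T A := by simp [edgesIn, hw]
  rw [subtreeTerm, subtreeTerm, Finset.prod_insert hw, edgesIn_insert_leaf hp hadj,
    Finset.prod_insert hedge, degIn_insert_leaf_self hp hadj, hvertices, hweight,
    Nat.cast_one, sub_self, zpow_zero]
  ring

variable {r : V}

lemma singleton_mem_subtrees (w : V) : {w} ∈ subtrees T := by
  simp [subtrees, SimpleGraph.IsTree.of_subsingleton]

lemma empty_notMem_subtrees : ∅ ∉ subtrees T := by
  simp only [subtrees, Finset.mem_filter_univ]
  exact fun h => by simpa using h.connected.nonempty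

lemma mem_subtrees_iff_connected (hT : T.IsTree) {A : Finset V} :
    A ∈ subtrees T ↔ (T.induce (A : Set V)).Connected := by
  simp [subtrees, SimpleGraph.isTree_iff, hT.isAcyclic.induce]

lemma insert_mem_subtrees_iff [DecidableEq V] (hT : T.IsTree) {A : Finset V} {w : V}
    (hA : A.Nonempty) (hw : w ∉ A) (hdeepest : ∀ k ∈ A, T.dist r k ≤ T.dist r w) :
    insert w A ∈ subtrees T ↔ A ∈ subtrees T ∧ ∃ p ∈ A, w ∈ children T r p := by
  have hchild {p : V} (hp : p ∈ A) : T.Adj w p ↔ w ∈ children T r p :=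
    ⟨fun h => mem_children_of_adj_of_dist_le hT h.symm (hdeepest p hp),
      fun h => (mem_children.1 h).1.symm⟩
  have hleaf : (T.neighborSet w ∩ A).Subsingleton := fun p hp q hq =>
    eq_of_mem_children hT ((hchild hp.2).1 hp.1) ((hchild hq.2).1 hq.1)
  rw [mem_subtrees_iff_connected hT, mem_subtrees_iff_connected hT, Finset.coe_insert,
    connected_induce_insert_iff (Finset.coe_nonempty.2 hA) (Finset.mem_coe.not.2 hw) hleaf]
  exact and_congr_right fun _ => exists_congr fun p => and_congr_right hchild

/-- The product of the factors `1 + (c_{k,j} / c_k) y_j` over the pairs of a vertex `k ∈ A` and a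
child `j ∉ W` of `k`: for `y = Φ_r(x)`, it accounts for all ways to extend the subtree on `A` by
vertices outside `W`. -/
def outerFactor [DecidableEq V] (T : SimpleGraph V) (C : TreeMatrix T) (r : V) (y : V → ℝ)
    (W A : Finset V) : ℝ :=
  ∏ k ∈ A, ∏ j ∈ children T r k \ W, (1 + C.c k j / C.c k k * y j)

lemma outerFactor_insert_of_forall_notMem [DecidableEq V] (C : TreeMatrix T) (y : V → ℝ)
    {W A : Finset V} {w : V} (h : ∀ k ∈ A, w ∉ children T r k) :
    outerFactor T C r y (insert w W) A = outerFactor T C r y W A :=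
  Finset.prod_congr rfl fun k hk => by
    rw [Finset.sdiff_insert, Finset.erase_eq_of_notMem fun hw => h k hk (Finset.mem_sdiff.1 hw).1]

lemma outerFactor_insert_mul_of_mem_children [DecidableEq V] (hT : T.IsTree) (C : TreeMatrix T)
    (y : V → ℝ) {W A : Finset V} {p w : V} (hp : p ∈ A) (hw : w ∈ children T r p) (hwW : w ∉ W) :
    outerFactor T C r y (insert w W) A * (1 + C.c p w / C.c p p * y w) =
      outerFactor T C r y W A := by
  have hrest : outerFactor T C r y (insert w W) (A.erase p) = outerFactor T C r y W (A.erase p) :=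
    outerFactor_insert_of_forall_notMem C y fun k hk hwk =>
      (Finset.mem_erase.1 hk).1 (eq_of_mem_children hT hwk hw)
  simp only [outerFactor] at hrest ⊢
  rw [← Finset.mul_prod_erase A _ hp, ← Finset.mul_prod_erase A _ hp, hrest, Finset.sdiff_insert,
    ← Finset.prod_erase_mul _ _ (Finset.mem_sdiff.2 ⟨hw, hwW⟩)]
  ring

lemma outerFactor_insert_deepest [DecidableEq V] (C : TreeMatrix T) (x : V → ℝ) {W A : Finset V}
    {w : V} (hwA : w ∉ A) (hdeepest : ∀ k ∈ W, T.dist r k ≤ T.dist r w) :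
    x w * outerFactor T C r (phi T C r x) (insert w W) (insert w A) =
      phi T C r x w * outerFactor T C r (phi T C r x) (insert w W) A := by
  have hchildren : Disjoint (children T r w) (insert w W) :=
    Finset.disjoint_right.2 fun j hj => notMem_children_of_dist_le <|
      (Finset.mem_insert.1 hj).elim (fun h => h ▸ le_rfl) (hdeepest j)
  rw [outerFactor, Finset.prod_insert hwA, Finset.sdiff_eq_self_of_disjoint hchildren, ← mul_assoc,
    ← phi_eq, outerFactor]

/-- The contribution to the energy of all subtrees of `T` that extend the one on `A` by vertices
outside `W`, when `W` is closed under taking parents. -/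
def extendedTerm [DecidableEq V] (T : SimpleGraph V) (C : TreeMatrix T) (r : V) (x : V → ℝ)
    (W A : Finset V) : ℝ :=
  subtreeTerm T C x A * outerFactor T C r (phi T C r x) W A

lemma extendedTerm_insert_singleton [DecidableEq V] (C : TreeMatrix T) (x : V → ℝ) {W : Finset V}
    {w : V} (hdeepest : ∀ k ∈ W, T.dist r k ≤ T.dist r w) :
    extendedTerm T C r x (insert w W) {w} = C.c w w * phi T C r x w := by
  have houter := outerFactor_insert_deepest C x (Finset.notMem_empty w) hdeepest
  rw [insert_empty_eq] at houter
  rw [extendedTerm, subtreeTerm_singleton, mul_assoc, houter]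
  simp [outerFactor]

lemma extendedTerm_insert_add [DecidableEq V] (hT : T.IsTree) (C : TreeMatrix T) (x : V → ℝ)
    {W A : Finset V} {p w : V} (hA : A ⊆ W) (hwW : w ∉ W)
    (hdeepest : ∀ k ∈ W, T.dist r k ≤ T.dist r w) (hp : p ∈ A) (hw : w ∈ children T r p) :
    extendedTerm T C r x (insert w W) A + extendedTerm T C r x (insert w W) (insert w A) =
      extendedTerm T C r x W A := by
  have hwA : w ∉ A := fun h => hwW (hA h)
  have hadj : ∀ l ∈ A, T.Adj l w ↔ l = p := fun l hl =>
    ⟨fun h => eq_of_mem_children hT (mem_children_of_adj_of_dist_le hT h (hdeepest l (hA hl))) hw,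
      fun h => h ▸ (mem_children.1 hw).1⟩
  have hw_outer := outerFactor_insert_deepest C x hwA hdeepest
  simp only [extendedTerm, subtreeTerm_insert_leaf C x hwA hp hadj,
    ← outerFactor_insert_mul_of_mem_children hT C (phi T C r x) hp hw hwW]
  linear_combination subtreeTerm T C x A * (C.c p w / C.c p p) * hw_outer

lemma extendedTerm_insert_of_forall_notMem [DecidableEq V] (C : TreeMatrix T) (x : V → ℝ)
    {W A : Finset V} {w : V} (h : ∀ k ∈ A, w ∉ children T r k) :
    extendedTerm T C r x (insert w W) A = extendedTerm T C r x W A := by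
  rw [extendedTerm, extendedTerm, outerFactor_insert_of_forall_notMem C _ h]

lemma ite_extendedTerm_add_ite_extendedTerm_insert [DecidableEq V] (hT : T.IsTree)
    (C : TreeMatrix T) (x : V → ℝ) {W A : Finset V} {w : V} (hA : A ⊆ W) (hwW : w ∉ W)
    (hdeepest : ∀ k ∈ W, T.dist r k ≤ T.dist r w) :
    ((if A ∈ subtrees T then extendedTerm T C r x (insert w W) A else 0) +
      if insert w A ∈ subtrees T then extendedTerm T C r x (insert w W) (insert w A) else 0) =
    (if A ∈ subtrees T then extendedTerm T C r x W A else 0) +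
      if A = ∅ then C.c w w * phi T C r x w else 0 := by
  rcases A.eq_empty_or_nonempty with rfl | hne
  · simp [empty_notMem_subtrees, singleton_mem_subtrees, extendedTerm_insert_singleton C x hdeepest]
  have hinsert := insert_mem_subtrees_iff hT hne (fun h => hwW (hA h)) fun k hk =>
    hdeepest k (hA hk)
  by_cases hparent : ∃ p ∈ A, w ∈ children T r p
  · obtain ⟨p, hp, hw⟩ := hparent
    simp [hinsert, hne.ne_empty, show ∃ p ∈ A, w ∈ children T r p from ⟨p, hp, hw⟩,
      ← extendedTerm_insert_add hT C x hA hwW hdeepest hp hw, ite_add_zero]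
  · have hnot : ∀ k ∈ A, w ∉ children T r k := by simpa using hparent
    simp [hinsert, hne.ne_empty, hparent, extendedTerm_insert_of_forall_notMem C x hnot]

lemma sum_extendedTerm_eq_sum_phi [DecidableEq V] (hT : T.IsTree) (C : TreeMatrix T) (r : V)
    (x : V → ℝ) (W : Finset V) :
    ∑ A ∈ W.powerset with A ∈ subtrees T, extendedTerm T C r x W A =
      ∑ i ∈ W, C.c i i * phi T C r x i := by
  induction W using Finset.induction_on_max_value (T.dist r) with
  | empty => simp [Finset.sum_filter, empty_notMem_subtrees]
  | insert w W hwW hdeepest ih =>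
    rw [Finset.sum_filter, Finset.sum_powerset_insert hwW, ← Finset.sum_add_distrib,
      Finset.sum_congr rfl fun A hA =>
        ite_extendedTerm_add_ite_extendedTerm_insert hT C x (Finset.mem_powerset.1 hA) hwW hdeepest,
      Finset.sum_add_distrib, ← Finset.sum_filter, ih, Finset.sum_insert hwW, add_comm]
    simp

theorem treeEnergy_eq_sum_phi (hT : T.IsTree) (C : TreeMatrix T) (r : V) (x : V → ℝ) :
    treeEnergy T C x = ∑ i, C.c i i * phi T C r x i := by
  classical
  rw [← sum_extendedTerm_eq_sum_phi hT]
  have houter A : outerFactor T C r (phi T C r x) Finset.univ A = 1 := by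
    simp [outerFactor, Finset.sdiff_eq_empty_iff_subset.2 (Finset.subset_univ _)]
  simp only [extendedTerm, houter, mul_one, Finset.powerset_univ, Finset.filter_univ_mem]
  rfl

end Energy

section Inverse

/-- The open positive orthant `(0, ∞)^V`, the support of the tree-Kummer density. -/
def posOrthant (V : Type*) : Set (V → ℝ) := {x | ∀ i, 0 < x i}

lemma measurableSet_posOrthant {V : Type*} [Countable V] : MeasurableSet (posOrthant V) := by
  simp_rw [posOrthant, Set.ofPred_forall]
  exact .iInter fun i => measurableSet_lt measurable_const (measurable_pi_apply i)

variable {V : Type*} [Fintype V] {T : SimpleGraph V} {r i j : V}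

/-- The factor by which `Φ_r` multiplies the coordinate `i`, in terms of the image point `y`. -/
def childFactor (T : SimpleGraph V) (C : TreeMatrix T) (r : V) (y : V → ℝ) (i : V) : ℝ :=
  ∏ j ∈ children T r i, (1 + C.c i j / C.c i i * y j)

/-- The inverse of `Φ_r` on the positive orthant. -/
def phiInv (T : SimpleGraph V) (C : TreeMatrix T) (r : V) (y : V → ℝ) (i : V) : ℝ :=
  y i * (childFactor T C r y i)⁻¹

variable (C : TreeMatrix T) {s y : V → ℝ}

lemma phi_eq_mul_childFactor (s : V → ℝ) :
    phi T C r s i = s i * childFactor T C r (phi T C r s) i :=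
  phi_eq T C r s i

lemma div_diag_pos_of_mem_children (h : j ∈ children T r i) : 0 < C.c i j / C.c i i :=
  div_pos (C.edge_pos _ _ (mem_children.1 h).1) (C.diag_pos _)

lemma one_add_div_diag_mul_pos (h : j ∈ children T r i) {t : ℝ} (ht : 0 < t) :
    0 < 1 + C.c i j / C.c i i * t :=
  add_pos one_pos (mul_pos (div_diag_pos_of_mem_children C h) ht)

lemma childFactor_pos (hy : ∀ j ∈ children T r i, 0 < y j) : 0 < childFactor T C r y i :=
  Finset.prod_pos fun j hj => one_add_div_diag_mul_pos C hj (hy j hj)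

lemma phi_mem_posOrthant (hs : s ∈ posOrthant V) : phi T C r s ∈ posOrthant V := fun i => by
  induction i using children_induction T r with
  | _ i ih =>
    rw [phi_eq_mul_childFactor]
    exact mul_pos (hs i) (childFactor_pos C ih)

lemma phiInv_mem_posOrthant (hy : y ∈ posOrthant V) : phiInv T C r y ∈ posOrthant V := fun i =>
  mul_pos (hy i) (inv_pos.2 (childFactor_pos C fun j _ => hy j))

lemma phiInv_phi (hs : s ∈ posOrthant V) : phiInv T C r (phi T C r s) = s := by
  funext i
  rw [phiInv, phi_eq_mul_childFactor, mul_inv_cancel_right₀]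
  exact (childFactor_pos C fun j _ => phi_mem_posOrthant C hs j).ne'

lemma phi_phiInv (hy : y ∈ posOrthant V) : phi T C r (phiInv T C r y) = y := by
  funext i
  induction i using children_induction T r with
  | _ i ih =>
    have hfactor : childFactor T C r (phi T C r (phiInv T C r y)) i = childFactor T C r y i :=
      Finset.prod_congr rfl fun j hj => by rw [ih j hj]
    rw [phi_eq_mul_childFactor, hfactor, phiInv, inv_mul_cancel_right₀]
    exact (childFactor_pos C fun j _ => hy j).ne'

lemma phiInv_image_posOrthant (r : V) : phiInv T C r '' posOrthant V = posOrthant V :=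
  Set.Subset.antisymm (Set.image_subset_iff.2 fun _ hy => phiInv_mem_posOrthant C hy)
    fun s hs => ⟨phi T C r s, phi_mem_posOrthant C hs, phiInv_phi C hs⟩

lemma measurable_phi (r : V) : Measurable (phi T C r) := by
  refine measurable_pi_lambda _ fun i => ?_
  induction i using children_induction T r with
  | _ i ih =>
    simp_rw [phi_eq (i := i)]
    exact (measurable_pi_apply i).mul
      (Finset.measurable_prod _ fun j hj => ((ih j hj).const_mul _).const_add _)

end Inverse

section Jacobian

lemma det_eq_prod_diag_of_forall_le {ι α R : Type*} [Fintype ι] [DecidableEq ι] [LinearOrder α]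
    [CommRing R] (M : Matrix ι ι R) (d : ι → α) (hM : ∀ i j, i ≠ j → d j ≤ d i → M i j = 0) :
    M.det = ∏ i, M i i := by
  have htriangular : M.BlockTriangular d := fun i j hij =>
    hM i j (fun h => hij.ne' (congrArg d h)) hij.le
  rw [htriangular.det, ← Finset.prod_fiberwise_of_maps_to (t := Finset.univ.image d) (g := d)
    (fun i _ => Finset.mem_image_of_mem _ (Finset.mem_univ i))]
  refine Finset.prod_congr rfl fun n _ => ?_
  have hdiag : M.toSquareBlock d n = Matrix.diagonal fun i : {i // d i = n} => M i i := by
    ext i j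
    by_cases hij : i = j
    · simp [hij, Matrix.toSquareBlock_def]
    · rw [Matrix.diagonal_apply_ne _ hij]
      exact hM i j (fun h => hij (Subtype.ext h)) (by rw [i.2, j.2])
  rw [hdiag, Matrix.det_diagonal]
  exact (Finset.prod_subtype _ (by simp) fun i => M i i).symm

variable {V : Type*} [Fintype V] {T : SimpleGraph V} {r i j : V} (C : TreeMatrix T) {y : V → ℝ}

lemma differentiableAt_phiInv (hy : y ∈ posOrthant V) : DifferentiableAt ℝ (phiInv T C r) y := by
  have hfactor (i : V) : Differentiable ℝ fun y => childFactor T C r y i := by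
    unfold childFactor
    fun_prop
  exact differentiableAt_pi.2 fun i => (differentiableAt_apply i y).mul
    ((hfactor i y).inv (childFactor_pos C fun j _ => hy j).ne')

lemma childFactor_add_single [DecidableEq V] (y : V → ℝ) (t : ℝ) (hj : j ∉ children T r i) :
    childFactor T C r (y + t • Pi.single j 1) i = childFactor T C r y i :=
  Finset.prod_congr rfl fun k hk => by simp [ne_of_mem_of_not_mem hk hj]

lemma fderiv_phiInv_single [DecidableEq V] (hy : y ∈ posOrthant V) (hj : j ∉ children T r i) :
    fderiv ℝ (phiInv T C r) y (Pi.single j 1) i =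
      if i = j then (childFactor T C r y i)⁻¹ else 0 := by
  have hdiff := differentiableAt_phiInv (r := r) C hy
  calc fderiv ℝ (phiInv T C r) y (Pi.single j 1) i
      = fderiv ℝ (fun y => phiInv T C r y i) y (Pi.single j 1) := by rw [fderiv_apply hdiff]; rfl
    _ = lineDeriv ℝ (fun y => phiInv T C r y i) y (Pi.single j 1) :=
        ((differentiableAt_pi.1 hdiff i).lineDeriv_eq_fderiv).symm
    _ = if i = j then (childFactor T C r y i)⁻¹ else 0 := by
        simp only [lineDeriv, phiInv, childFactor_add_single C y _ hj, Pi.add_apply, Pi.smul_apply,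
          smul_eq_mul]
        by_cases hij : i = j <;> simp [hij]

lemma det_fderiv_phiInv (hy : y ∈ posOrthant V) :
    (fderiv ℝ (phiInv T C r) y).det = ∏ i, (childFactor T C r y i)⁻¹ := by
  classical
  have hentry (i j : V) (hle : T.dist r j ≤ T.dist r i) :
      LinearMap.toMatrix' (fderiv ℝ (phiInv T C r) y : (V → ℝ) →ₗ[ℝ] V → ℝ) i j =
        if i = j then (childFactor T C r y i)⁻¹ else 0 := by
    rw [← fderiv_phiInv_single C hy (notMem_children_of_dist_le hle), LinearMap.toMatrix'_apply]
    congr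
  rw [ContinuousLinearMap.det, ← LinearMap.det_toMatrix',
    det_eq_prod_diag_of_forall_le _ (T.dist r) fun i j hij hle =>
      (hentry i j hle).trans (if_neg hij)]
  exact Finset.prod_congr rfl fun i _ => by rw [hentry i i le_rfl, if_pos rfl]

end Jacobian

section Components

variable {V : Type*} [Fintype V] {T : SimpleGraph V} {r i j : V}

open Classical in
/-- The set of parents of `i` when `T` is directed away from the root `r`. In a tree it is empty for
the root and a singleton for every other vertex, so a product over it is a factor that is absent at
the root. -/
def parents (T : SimpleGraph V) (r i : V) : Finset V :=
  Finset.univ.filter fun p => i ∈ children T r p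

lemma mem_parents : j ∈ parents T r i ↔ i ∈ children T r j := by
  simp [parents]

lemma parents_root : parents T r r = ∅ :=
  Finset.eq_empty_of_forall_notMem fun _ h => ne_root_of_mem_children (mem_parents.1 h) rfl

lemma parents_of_ne (hT : T.IsTree) (hi : i ≠ r) : parents T r i = {parent hT r i hi} :=
  Finset.eq_singleton_iff_unique_mem.2 ⟨mem_parents.2 (mem_children_parent hT hi),
    fun _ h => eq_of_mem_children hT (mem_parents.1 h) (mem_children_parent hT hi)⟩

lemma prod_children_eq_prod_parents {M : Type*} [CommMonoid M] (T : SimpleGraph V) (r : V)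
    (f : V → V → M) :
    ∏ i, ∏ j ∈ children T r i, f i j = ∏ j, ∏ i ∈ parents T r j, f i j :=
  Finset.prod_comm' fun _ _ => by simp [mem_parents]

/-- Unnormalized density of the component `i` of the image of `TK(a, C)` under `Φ_r`. -/
def componentWeight (T : SimpleGraph V) (a : V → ℝ) (C : TreeMatrix T) (r i : V) (x : ℝ) : ℝ :=
  (Set.Ioi (0 : ℝ)).indicator (fun x => x ^ (a i - 1) *
    (∏ p ∈ parents T r i, (1 + C.c p i / C.c p p * x) ^ (-a p)) * Real.exp (-(C.c i i * x))) x

variable (a : V → ℝ) (C : TreeMatrix T)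

lemma componentWeight_of_pos {x : ℝ} (hx : 0 < x) :
    componentWeight T a C r i x = x ^ (a i - 1) *
      (∏ p ∈ parents T r i, (1 + C.c p i / C.c p p * x) ^ (-a p)) * Real.exp (-(C.c i i * x)) :=
  Set.indicator_of_mem (Set.mem_Ioi.2 hx) _

lemma componentWeight_of_nonpos {x : ℝ} (hx : x ≤ 0) : componentWeight T a C r i x = 0 :=
  Set.indicator_of_notMem (by simpa using hx) _

lemma inv_childFactor_mul_phiInv_rpow {y : V → ℝ} (hy : y ∈ posOrthant V) (α : ℝ) :
    (childFactor T C r y i)⁻¹ * phiInv T C r y i ^ (α - 1) =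
      y i ^ (α - 1) * ∏ j ∈ children T r i, (1 + C.c i j / C.c i i * y j) ^ (-α) := by
  have hfactor : 0 < childFactor T C r y i := childFactor_pos C fun j _ => hy j
  rw [Real.finsetProd_rpow _ _ fun j hj => (one_add_div_diag_mul_pos C hj (hy j)).le]
  calc (childFactor T C r y i)⁻¹ * phiInv T C r y i ^ (α - 1)
      = y i ^ (α - 1) * (childFactor T C r y i ^ (-1 : ℝ) * childFactor T C r y i ^ (1 - α)) := by
        rw [phiInv, Real.mul_rpow (hy i).le (inv_pos.2 hfactor).le, Real.inv_rpow hfactor.le,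
          ← Real.rpow_neg hfactor.le, neg_sub, Real.rpow_neg_one, mul_left_comm]
    _ = y i ^ (α - 1) * childFactor T C r y i ^ (-α) := by
        rw [← Real.rpow_add hfactor]
        ring_nf

lemma treeKummerWeight_of_mem_posOrthant {x : V → ℝ} (hx : x ∈ posOrthant V) :
    treeKummerWeight T a C x = (∏ i, x i ^ (a i - 1)) * Real.exp (-treeEnergy T C x) :=
  Set.indicator_of_mem hx _

lemma prod_componentWeight_eq_abs_det_mul (hT : T.IsTree) (r : V) {y : V → ℝ}
    (hy : y ∈ posOrthant V) :
    ∏ i, componentWeight T a C r i (y i) =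
      |(fderiv ℝ (phiInv T C r) y).det| * treeKummerWeight T a C (phiInv T C r y) := by
  have hdet : 0 < ∏ i, (childFactor T C r y i)⁻¹ :=
    Finset.prod_pos fun i _ => inv_pos.2 (childFactor_pos C fun j _ => hy j)
  have henergy : treeEnergy T C (phiInv T C r y) = ∑ i, C.c i i * y i := by
    rw [treeEnergy_eq_sum_phi hT C r, phi_phiInv C hy]
  have hmonomial : (∏ i, (childFactor T C r y i)⁻¹) * ∏ i, phiInv T C r y i ^ (a i - 1) =
      (∏ i, y i ^ (a i - 1)) *
        ∏ i, ∏ p ∈ parents T r i, (1 + C.c p i / C.c p p * y i) ^ (-a p) := by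
    rw [← prod_children_eq_prod_parents T r fun p i => (1 + C.c p i / C.c p p * y i) ^ (-a p),
      ← Finset.prod_mul_distrib, ← Finset.prod_mul_distrib]
    exact Finset.prod_congr rfl fun i _ => inv_childFactor_mul_phiInv_rpow C hy (a i)
  rw [det_fderiv_phiInv C hy, abs_of_pos hdet,
    treeKummerWeight_of_mem_posOrthant a C (phiInv_mem_posOrthant C hy), henergy, ← mul_assoc,
    hmonomial, ← Finset.sum_neg_distrib, Real.exp_sum, ← Finset.prod_mul_distrib,
    ← Finset.prod_mul_distrib]
  exact Finset.prod_congr rfl fun i _ => componentWeight_of_pos a C (hy i)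

lemma support_prod_componentWeight_subset (r : V) :
    (Function.support fun y : V → ℝ => ∏ i, componentWeight T a C r i (y i)) ⊆ posOrthant V :=
  fun y hy i => by
    by_contra! hi
    exact hy (Finset.prod_eq_zero (Finset.mem_univ i) (componentWeight_of_nonpos a C hi))

theorem map_phi_treeKummerMeasure_eq_densityPropTo (hT : T.IsTree) (r : V) :
    (treeKummerMeasure T a C).map (phi T C r) =
      densityPropTo volume fun y => ∏ i, componentWeight T a C r i (y i) := by
  refine map_densityPropTo_of_leftInvOn measurableSet_posOrthant
    (measurable_phi C r)
    (fun y hy => (differentiableAt_phiInv C hy).hasFDerivAt.hasFDerivWithinAt)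
    (fun y hy => phi_phiInv C hy) ?_ (support_prod_componentWeight_subset a C r)
    fun y hy => prod_componentWeight_eq_abs_det_mul a C hT r hy
  rw [phiInv_image_posOrthant C r]
  exact Set.support_indicator_subset

lemma measurable_componentWeight (r i : V) : Measurable (componentWeight T a C r i) := by
  refine Measurable.indicator ?_ measurableSet_Ioi
  fun_prop

lemma componentWeight_pos (r i : V) {x : ℝ} (hx : 0 < x) : 0 < componentWeight T a C r i x := by
  have hprod : 0 < ∏ p ∈ parents T r i, (1 + C.c p i / C.c p p * x) ^ (-a p) :=
    Finset.prod_pos fun p hp =>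
      Real.rpow_pos_of_pos (one_add_div_diag_mul_pos C (mem_parents.1 hp) hx) _
  rw [componentWeight_of_pos a C hx]
  positivity

lemma componentWeight_nonneg (r i : V) (x : ℝ) : 0 ≤ componentWeight T a C r i x := by
  rcases le_or_gt x 0 with hx | hx
  · exact (componentWeight_of_nonpos a C hx).ge
  · exact (componentWeight_pos a C r i hx).le

lemma lintegral_componentWeight_ne_zero (r i : V) :
    ∫⁻ x, ENNReal.ofReal (componentWeight T a C r i x) ≠ 0 := by
  have hsupport : Set.Ioi (0 : ℝ) ⊆
      (fun x => ENNReal.ofReal (componentWeight T a C r i x)).support := fun x hx =>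
    (ENNReal.ofReal_pos.2 (componentWeight_pos a C r i hx)).ne'
  rw [← pos_iff_ne_zero,
    lintegral_pos_iff_support (measurable_componentWeight a C r i).ennreal_ofReal]
  exact lt_of_lt_of_le (by simp) (measure_mono hsupport)

lemma rpow_mul_exp_eq_mul_gammaPDFReal {α γ x : ℝ} (hα : 0 < α) (hγ : 0 < γ) (hx : 0 ≤ x) :
    x ^ (α - 1) * Real.exp (-(γ * x)) = Real.Gamma α / γ ^ α * gammaPDFReal α γ x := by
  rw [gammaPDFReal, if_pos hx]
  field_simp

variable {a}

lemma componentWeight_le_mul_gammaPDFReal (ha : ∀ i, 0 < a i) (r i : V) (x : ℝ) :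
    componentWeight T a C r i x ≤
      Real.Gamma (a i) / C.c i i ^ a i * gammaPDFReal (a i) (C.c i i) x := by
  have hai := ha i
  have hc := C.diag_pos i
  rcases le_or_gt x 0 with hx | hx
  · rw [componentWeight_of_nonpos a C hx]
    exact mul_nonneg (by positivity) (gammaPDFReal_nonneg hai hc x)
  have hprod : ∏ p ∈ parents T r i, (1 + C.c p i / C.c p p * x) ^ (-a p) ≤ 1 := by
    refine Finset.prod_le_one (fun p hp => ?_) fun p hp => ?_
    · exact Real.rpow_nonneg (one_add_div_diag_mul_pos C (mem_parents.1 hp) hx).le _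
    · have hratio := div_diag_pos_of_mem_children C (mem_parents.1 hp)
      exact Real.rpow_le_one_of_one_le_of_nonpos (le_add_of_nonneg_right (by positivity))
        (neg_nonpos.2 (ha p).le)
  rw [componentWeight_of_pos a C hx, ← rpow_mul_exp_eq_mul_gammaPDFReal hai hc hx.le]
  gcongr
  exact mul_le_of_le_one_right (by positivity) hprod

lemma lintegral_componentWeight_ne_top (ha : ∀ i, 0 < a i) (r i : V) :
    ∫⁻ x, ENNReal.ofReal (componentWeight T a C r i x) ≠ ∞ := by
  have hai := ha i
  have hc := C.diag_pos i
  refine ne_top_of_le_ne_top (ENNReal.ofReal_ne_top (r := Real.Gamma (a i) / C.c i i ^ a i)) ?_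
  calc ∫⁻ x, ENNReal.ofReal (componentWeight T a C r i x)
      ≤ ∫⁻ x, ENNReal.ofReal (Real.Gamma (a i) / C.c i i ^ a i) * gammaPDF (a i) (C.c i i) x := by
        refine lintegral_mono fun x => ?_
        rw [gammaPDF, ← ENNReal.ofReal_mul (by positivity)]
        exact ENNReal.ofReal_le_ofReal (componentWeight_le_mul_gammaPDFReal C ha r i x)
    _ = ENNReal.ofReal (Real.Gamma (a i) / C.c i i ^ a i) := by
        rw [lintegral_const_mul' _ _ ENNReal.ofReal_ne_top, lintegral_gammaPDF_eq_one hai hc,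
          mul_one]

/-- The law of the component `i` of the image of `TK(a, C)` under `Φ_r`. -/
def componentMeasure (T : SimpleGraph V) (a : V → ℝ) (C : TreeMatrix T) (r i : V) : Measure ℝ :=
  densityPropTo volume (componentWeight T a C r i)

lemma isProbabilityMeasure_componentMeasure (ha : ∀ i, 0 < a i) (r i : V) :
    IsProbabilityMeasure (componentMeasure T a C r i) :=
  isProbabilityMeasure_densityPropTo (lintegral_componentWeight_ne_zero a C r i)
    (lintegral_componentWeight_ne_top C ha r i)

theorem map_phi_treeKummerMeasure (hT : T.IsTree) (ha : ∀ i, 0 < a i) (r : V) :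
    (treeKummerMeasure T a C).map (phi T C r) = Measure.pi (componentMeasure T a C r) := by
  rw [map_phi_treeKummerMeasure_eq_densityPropTo a C hT r, volume_pi]
  exact densityPropTo_pi (measurable_componentWeight a C r) (componentWeight_nonneg a C r)
    (lintegral_componentWeight_ne_zero a C r) (lintegral_componentWeight_ne_top C ha r)

lemma componentMeasure_root (ha : 0 < a r) :
    componentMeasure T a C r r = gammaMeasure (a r) (C.c r r) := by
  have hc := C.diag_pos r
  have hweight : componentWeight T a C r r =ᵐ[volume]
      fun x => Real.Gamma (a r) / C.c r r ^ a r * gammaPDFReal (a r) (C.c r r) x := by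
    filter_upwards [Measure.ae_ne volume (0 : ℝ)] with x hx
    rcases hx.lt_or_gt with hx | hx
    · rw [componentWeight_of_nonpos a C hx.le, gammaPDFReal, if_neg hx.not_ge, mul_zero]
    · rw [componentWeight_of_pos a C hx, parents_root, Finset.prod_empty, mul_one,
        rpow_mul_exp_eq_mul_gammaPDFReal ha hc hx.le]
  rw [componentMeasure, densityPropTo_congr_ae hweight, densityPropTo_const_mul _ _ (by positivity),
    densityPropTo_eq_withDensity (lintegral_gammaPDF_eq_one ha hc)]
  rfl

lemma componentWeight_inv_mul_eq_mul_kummerWeight {p : V} (hp : parents T r i = {p}) (y : ℝ) :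
    componentWeight T a C r i ((C.c p i / C.c p p)⁻¹ * y) =
      (C.c p i / C.c p p)⁻¹ ^ (a i - 1) *
        kummerWeight (a i) (a p - a i) (C.c p p * C.c i i / C.c p i) y := by
  have hratio : 0 < C.c p i / C.c p p :=
    div_diag_pos_of_mem_children C (mem_parents.1 (hp ▸ Finset.mem_singleton_self p))
  rcases le_or_gt y 0 with hy | hy
  · rw [componentWeight_of_nonpos a C (mul_nonpos_of_nonneg_of_nonpos (by positivity) hy),
      kummerWeight, Set.indicator_of_notMem (by simpa using hy), mul_zero]
  · have hexp : C.c i i * ((C.c p i / C.c p p)⁻¹ * y) = C.c p p * C.c i i / C.c p i * y := by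
      rw [inv_div]
      ring
    rw [componentWeight_of_pos a C (by positivity), hp, Finset.prod_singleton,
      mul_inv_cancel_left₀ hratio.ne', hexp, kummerWeight, Set.indicator_of_mem (Set.mem_Ioi.2 hy),
      Real.mul_rpow (by positivity) hy.le, Real.rpow_neg (by positivity), add_sub_cancel,
      div_eq_mul_inv (y ^ _)]
    ring

lemma map_const_mul_componentMeasure {p : V} (hp : parents T r i = {p}) :
    (componentMeasure T a C r i).map (C.c p i / C.c p p * ·) =
      kummerMeasure (a i) (a p - a i) (C.c p p * C.c i i / C.c p i) := by
  have hratio : 0 < C.c p i / C.c p p :=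
    div_diag_pos_of_mem_children C (mem_parents.1 (hp ▸ Finset.mem_singleton_self p))
  rw [componentMeasure, map_const_mul_densityPropTo hratio.ne']
  simp_rw [componentWeight_inv_mul_eq_mul_kummerWeight C hp]
  exact densityPropTo_const_mul _ _ (by positivity)

end Components

end TreeKummer

end

theorem theorem3p2 {V : Type*} [Fintype V] (T : SimpleGraph V) (hT : T.IsTree)
    (hp : 2 ≤ Fintype.card V) (a : V → ℝ) (ha : ∀ i, 0 < a i) (C : TreeKummer.TreeMatrix T)
    {Ω : Type*} [MeasurableSpace Ω] (μ : MeasureTheory.Measure Ω)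
    [MeasureTheory.IsProbabilityMeasure μ] (S : Ω → V → ℝ)
    (hS : ProbabilityTheory.HasLaw S (TreeKummer.treeKummerMeasure T a C) μ) (r : V) :
    ProbabilityTheory.iIndepFun (fun i ω => TreeKummer.phi T C r (S ω) i) μ ∧
    ProbabilityTheory.HasLaw (fun ω => TreeKummer.phi T C r (S ω) r)
      (ProbabilityTheory.gammaMeasure (a r) (C.c r r)) μ ∧
    ∀ (i : V) (hi : i ≠ r) (p : V), p = TreeKummer.parent hT r i hi →
      ProbabilityTheory.HasLaw
        (fun ω => C.c p i / C.c p p * TreeKummer.phi T C r (S ω) i)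
        (TreeKummer.kummerMeasure (a i) (a p - a i) (C.c p p * C.c i i / C.c p i)) μ := by
  have hprob := TreeKummer.isProbabilityMeasure_componentMeasure C ha r
  have hphi : HasLaw (fun ω => TreeKummer.phi T C r (S ω))
      (Measure.pi (TreeKummer.componentMeasure T a C r)) μ :=
    HasLaw.fun_comp ⟨(TreeKummer.measurable_phi C r).aemeasurable,
      TreeKummer.map_phi_treeKummerMeasure C hT ha r⟩ hS
  have hcomponent (i : V) : HasLaw (fun ω => TreeKummer.phi T C r (S ω) i)
      (TreeKummer.componentMeasure T a C r i) μ :=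
    (measurePreserving_eval _ i).hasLaw.fun_comp hphi
  refine ⟨(iIndepFun_iff_hasLaw_pi_pi hcomponent).2 hphi, ?_, ?_⟩
  · exact TreeKummer.componentMeasure_root C (ha r) ▸ hcomponent r
  · rintro i hi p rfl
    exact HasLaw.fun_comp ⟨(measurable_const_mul _).aemeasurable,
      TreeKummer.map_const_mul_componentMeasure C (TreeKummer.parents_of_ne hT hi)⟩ (hcomponent i)
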